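/- Let $A$ be a commutative Noetherian ring, let $R=A[[x]]=A[[x_1,\dots,x_n]]$ be the formal power series ring over $A$ in $n\ge 0$ variables, and let $M$ be a finitely generated $R$-module. For $\mathfrak p\in\operatorname{Spec}A$ with residue field $k(\mathfrak p)=A_{\mathfrak p}/\mathfrak pA_{\mathfrak p}$, the completed fibre of $M$ over $\mathfrak p$ is the $k(\mathfrak p)$-vector space $$\hat M(\mathfrak p)=M\,\hat\otimes_A\,k(\mathfrak p):=\varprojlim_m\Big(\big(M/\langle x_1,\dots,x_n\rangle^mM\big)\otimes_A k(\mathfrak p)\Big),$$ and the completed fibre dimension of $M$ over $\mathfrak p$ is $\hat d_{\mathfrak p}(M):=\dim_{k(\mathfrak p)}\hat M(\mathfrak p)\in\mathbb N\cup\{\infty\}$. Let $\operatorname{Supp}_A(M)=\{\mathfrak q\in\operatorname{Spec}A : M_{\mathfrak q}\neq 0\}$, and let $\dim_{\mathfrak p}(\operatorname{Supp}_A(M))$ denote its dimension at $\mathfrak p$, i.e. the infimum, over all open neighbourhoods $V$ of $\mathfrak p$ in $\operatorname{Spec}A$, of the Krull dimension of the topological space $V\cap\operatorname{Supp}_A(M)$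 (the empty space having dimension $-\infty$). Let $\mathfrak p\in\operatorname{Spec}A$. If $\dim_{\mathfrak p}(\operatorname{Supp}_A(M))\le 1$, then there is an open neighbourhood $U$ of $\mathfrak p$ in $\operatorname{Spec}A$ such that $$\hat d_{\mathfrak q}(M)\le\hat d_{\mathfrak p}(M)\qquad\text{for all }\mathfrak q\in U.$$ -/

import Mathlib

open scoped TensorProduct

/-- The ideal `⟨x₁, …, xₙ⟩` of `A⟦x₁, …, xₙ⟧` generated by the variables. -/
noncomputable def variableIdeal (A : Type*) [CommRing A] (n : ℕ) : Ideal (MvPowerSeries (Fin n) A) :=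
  Ideal.span (Set.range (fun i : Fin n => (MvPowerSeries.X i : MvPowerSeries (Fin n) A)))

section CompletedTensor

variable {A : Type*} [CommRing A]

/-- The quotient `M / ⟨x⟩ᵐ M` of an `A⟦x⟧`-module `M`. -/
abbrev TruncatedModule (A : Type*) [CommRing A] (n : ℕ) (M : Type*) [AddCommGroup M]
    [Module (MvPowerSeries (Fin n) A) M] (m : ℕ) : Type _ :=
  M ⧸ (variableIdeal A n ^ m • ⊤ : Submodule (MvPowerSeries (Fin n) A) M)

/-- The `B`-linear transition map `B ⊗[A] (M / ⟨x⟩ˡ M) → B ⊗[A] (M / ⟨x⟩ᵐ M)` for `m ≤ l`,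
induced by the canonical projection. -/
noncomputable def truncatedTransition (n : ℕ) (M : Type*) [AddCommGroup M] [Module A M]
    [Module (MvPowerSeries (Fin n) A) M] [IsScalarTower A (MvPowerSeries (Fin n) A) M]
    (B : Type*) [CommRing B] [Algebra A B] {m l : ℕ} (h : m ≤ l) :
    B ⊗[A] TruncatedModule A n M l →ₗ[B] B ⊗[A] TruncatedModule A n M m :=
  LinearMap.baseChange B
    ((Submodule.factorPow (variableIdeal A n) M h).restrictScalars A)

/-- The completed tensor product `M ⊗̂_A B = lim_m ((M / ⟨x⟩ᵐ M) ⊗_A B)` of an `A⟦x⟧`-module `M`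
and an `A`-algebra `B`, with its `B`-module structure: the compatible families in the product. -/
noncomputable def completedTensorProduct (n : ℕ) (M : Type*) [AddCommGroup M] [Module A M]
    [Module (MvPowerSeries (Fin n) A) M] [IsScalarTower A (MvPowerSeries (Fin n) A) M]
    (B : Type*) [CommRing B] [Algebra A B] :
    Submodule B (∀ m : ℕ, B ⊗[A] TruncatedModule A n M m) where
  carrier := {f | ∀ (m l : ℕ) (h : m ≤ l), truncatedTransition n M B h (f l) = f m}
  add_mem' := by
    intro f g hf hg m l h
    rw [Pi.add_apply, map_add, hf m l h, hg m l h, Pi.add_apply]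
  zero_mem' := by
    intro m l h
    rw [Pi.zero_apply, map_zero, Pi.zero_apply]
  smul_mem' := by
    intro b f hf m l h
    rw [Pi.smul_apply, map_smul, hf m l h, Pi.smul_apply]

/-- The completed fibre dimension `d̂_p(M) = dim_{k(p)} (M ⊗̂_A k(p))` of an `A⟦x⟧`-module `M` at
a prime `p` of `A`, with values in `ℕ∞`; here `k(p)` is the residue field of `p`. -/
noncomputable def completedFibreDim (n : ℕ) (M : Type*) [AddCommGroup M] [Module A M]
    [Module (MvPowerSeries (Fin n) A) M] [IsScalarTower A (MvPowerSeries (Fin n) A) M]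
    (p : PrimeSpectrum A) : ℕ∞ :=
  Cardinal.toENat
    (Module.rank p.asIdeal.ResidueField
      (completedTensorProduct (A := A) n M p.asIdeal.ResidueField))

end CompletedTensor

/-- The dimension `dim_x(S)` at a point `x` of a subset `S` of a topological space: the infimum,
over the open neighbourhoods `U` of `x`, of the Krull dimension of the subspace `U ∩ S`
(the empty space has dimension `⊥`). -/
noncomputable def localKrullDimAt {X : Type*} [TopologicalSpace X] (S : Set X) (x : X) :
    WithBot ℕ∞ :=
  ⨅ (U : Set X) (_ : IsOpen U ∧ x ∈ U), topologicalKrullDim (U ∩ S : Set X)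

/-! The completed fibre dimension at `q` is the supremum over `m` of the fibre dimensions of
`M/⟨x⟩ᵐM`. These quotients are finite over `A`, so each fibre dimension is upper semicontinuous, but
the neighbourhood depends on `m`. Two cases avoid this dependence. A generization of `p` lies in
every neighbourhood of `p`, so its dimension is at most that of `p` (`truncatedFibreDim_le_of_le`).
If the dimensions at a prime `η` are bounded, they stabilise at some `m₀`; then one `a ∉ η`
multiplies `⟨x⟩^m₀ M` into `⟨x⟩^(m₀+1) M + ηM`, and this inclusion propagates to all higher powers.
So at every `q ⊇ η` with `a ∉ q` the dimensions also stabilise at `m₀`, and semicontinuity at that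
single level suffices (`exists_notMem_forall_truncatedFibreDim_le`).

Assume the dimension at `p` is finite. The second case, applied to the minimal primes `η ⊆ p` of
`Ann M`, leaves only primes containing some `η + (a)`, hence a minimal prime `ζ` of it. Near `p` all
relevant `ζ` lie below `p`, and since the support has dimension at most one, `η < ζ ≤ q` forces `q =
ζ ≤ p`: the first case. -/

/-! ### Fibres of modules at a prime -/

theorem exists_open_finrank_fiber_le {A : Type*} [CommRing A] (N : Type*) [AddCommGroup N]
    [Module A N] [Module.Finite A N] (p : PrimeSpectrum A) :
    ∃ U : Set (PrimeSpectrum A), IsOpen U ∧ p ∈ U ∧ ∀ q ∈ U,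
      Module.finrank q.asIdeal.ResidueField (q.asIdeal.ResidueField ⊗[A] N) ≤
        Module.finrank p.asIdeal.ResidueField (p.asIdeal.ResidueField ⊗[A] N) := by
  classical
  have hspan (q : PrimeSpectrum A) : Submodule.span q.asIdeal.ResidueField
      (Set.range (fun y : N => (1 : q.asIdeal.ResidueField) ⊗ₜ[A] y)) = ⊤ := by
    rw [eq_top_iff]
    intro z _
    induction z with
    | zero => exact zero_mem _
    | add x y hx hy => exact add_mem (hx trivial) (hy trivial)
    | tmul c y =>
      have : c ⊗ₜ[A] y = c • ((1 : q.asIdeal.ResidueField) ⊗ₜ[A] y) := by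
        simp [TensorProduct.smul_tmul']
      rw [this]
      exact Submodule.smul_mem _ _ (Submodule.subset_span ⟨y, rfl⟩)
  obtain ⟨t, htr, hts, hti⟩ := exists_linearIndependent p.asIdeal.ResidueField
    (Set.range (fun y : N => (1 : p.asIdeal.ResidueField) ⊗ₜ[A] y))
  rw [hspan p] at hts
  have htfin : t.Finite := hti.setFinite
  have := htfin.fintype
  choose g hg using fun i : t => htr i.2
  have hcard : Fintype.card t =
      Module.finrank p.asIdeal.ResidueField (p.asIdeal.ResidueField ⊗[A] N) := by
    rw [← finrank_span_eq_card hti, Subtype.range_coe, hts, finrank_top]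
  let L : Submodule A N := Submodule.span A (Set.range g)
  -- `L` is generated by lifts of a basis of the fibre at `p`. Where `N ⧸ L` has zero fibre these
  -- lifts span the fibre of `N`, and the support of the finite module `N ⧸ L` is closed.
  refine ⟨(Module.support A (N ⧸ L))ᶜ, Module.isClosed_support.isOpen_compl, ?_, ?_⟩
  · rw [Set.mem_compl_iff, Module.mem_support_iff_nontrivial_residueField_tensorProduct,
      not_nontrivial_iff_subsingleton]
    have hzero : L.mkQ.baseChange p.asIdeal.ResidueField = 0 := by
      refine LinearMap.ext_on hts ?_
      intro x hx
      have h1 := hg ⟨x, hx⟩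
      dsimp only at h1
      rw [← h1, LinearMap.baseChange_tmul, LinearMap.zero_apply, Submodule.mkQ_apply,
        (Submodule.Quotient.mk_eq_zero L).2 (Submodule.subset_span ⟨_, rfl⟩),
        TensorProduct.tmul_zero]
    refine subsingleton_of_forall_eq 0 fun z => ?_
    obtain ⟨w, rfl⟩ := LinearMap.lTensor_surjective p.asIdeal.ResidueField L.mkQ_surjective z
    exact LinearMap.congr_fun hzero w
  · intro q hq
    rw [Set.mem_compl_iff, Module.mem_support_iff_nontrivial_residueField_tensorProduct,
      not_nontrivial_iff_subsingleton] at hq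
    rw [← hcard]
    refine finrank_le_of_span_eq_top
      (v := fun i : t => (1 : q.asIdeal.ResidueField) ⊗ₜ[A] g i) ?_
    rw [eq_top_iff]
    intro z _
    have hex := lTensor_exact q.asIdeal.ResidueField (f := L.subtype) (g := L.mkQ)
      (LinearMap.exact_subtype_mkQ L) L.mkQ_surjective
    obtain ⟨w, rfl⟩ := (hex z).1 (Subsingleton.elim _ _)
    induction w with
    | zero => simp
    | add x y hx hy => rw [map_add]; exact add_mem (hx trivial) (hy trivial)
    | tmul c y =>
      obtain ⟨y, hy⟩ := y
      rw [LinearMap.lTensor_tmul, Submodule.subtype_apply]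
      induction hy using Submodule.span_induction generalizing c with
      | mem x hx =>
        obtain ⟨i, rfl⟩ := hx
        have : c ⊗ₜ[A] g i = c • ((1 : q.asIdeal.ResidueField) ⊗ₜ[A] g i) := by
          simp [TensorProduct.smul_tmul']
        dsimp only
        rw [this]
        exact Submodule.smul_mem _ _ (Submodule.subset_span ⟨i, rfl⟩)
      | zero => simp
      | add x y _ _ hx hy =>
        dsimp only at hx hy ⊢
        rw [TensorProduct.tmul_add]; exact add_mem (hx c trivial) (hy c trivial)
      | smul a x _ hx =>
        dsimp only at hx ⊢
        rw [← TensorProduct.smul_tmul]; exact hx (a • c) trivial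

/-- The fibre is the localization of `N/pN` at the nonzero elements of the domain `A/p`, so the
kernel of `N/pN → k(p) ⊗ N` is torsion. -/
theorem exists_smul_mem_of_one_tmul_eq_zero {A : Type*} [CommRing A] {N : Type*} [AddCommGroup N]
    [Module A N] (p : Ideal A) [p.IsPrime] (y : N)
    (hy : (1 : p.ResidueField) ⊗ₜ[A] y = 0) : ∃ s ∉ p, s • y ∈ (p • ⊤ : Submodule A N) := by
  let P := N ⧸ (p • ⊤ : Submodule A N)
  have h1 : (1 : p.ResidueField) ⊗ₜ[A ⧸ p] (Submodule.Quotient.mk y : P) = 0 := by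
    have := congrArg (LinearMap.lTensor p.ResidueField (p • ⊤ : Submodule A N).mkQ) hy
    rw [LinearMap.lTensor_tmul, map_zero] at this
    have h2 := congrArg
      (TensorProduct.mapOfCompatibleSMul (A ⧸ p) A A p.ResidueField P) this
    simpa using h2
  have hloc : IsLocalizedModule (nonZeroDivisors (A ⧸ p))
      (TensorProduct.mk (A ⧸ p) p.ResidueField P 1) := inferInstance
  obtain ⟨⟨s, hs⟩, hsy⟩ := (IsLocalizedModule.eq_zero_iff (nonZeroDivisors (A ⧸ p))
      (TensorProduct.mk (A ⧸ p) p.ResidueField P 1)).1 h1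
  obtain ⟨s, rfl⟩ := Ideal.Quotient.mk_surjective s
  refine ⟨s, fun h => ?_, ?_⟩
  · exact nonZeroDivisors.ne_zero hs (Ideal.Quotient.eq_zero_iff_mem.2 h)
  · rw [← Submodule.Quotient.mk_eq_zero, Submodule.Quotient.mk_smul]
    exact hsy

/-! ### Power series, inverse systems and truncations -/

theorem MvPowerSeries.sub_C_constantCoeff_mem_variableIdeal {A : Type*} [CommRing A] {n : ℕ}
    (f : MvPowerSeries (Fin n) A) :
    f - MvPowerSeries.C (MvPowerSeries.constantCoeff f) ∈ variableIdeal A n := by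
  classical
  -- Each nonzero exponent is assigned one variable dividing its monomial; grouping terms by
  -- assigned variable gives the cofactors `g i`. `Option` supplies a value at `e = 0` even when `n
  -- = 0`.
  have hne (e : Fin n →₀ ℕ) : ∃ o : Option (Fin n), e ≠ 0 → ∃ i, o = some i ∧ e i ≠ 0 := by
    by_cases he : e = 0
    · exact ⟨none, fun h => absurd he h⟩
    · obtain ⟨i, hi⟩ : ∃ i, e i ≠ 0 := by
        by_contra! h; exact he (Finsupp.ext h)
      exact ⟨some i, fun _ => ⟨i, rfl, hi⟩⟩
  choose ι hι using hne
  let g (i : Fin n) : MvPowerSeries (Fin n) A := fun e =>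
    if ι (e + Finsupp.single i 1) = some i then
      MvPowerSeries.coeff (e + Finsupp.single i 1) f else 0
  have hfg : f - MvPowerSeries.C (MvPowerSeries.constantCoeff f) =
      ∑ i, MvPowerSeries.X i * g i := by
    ext e
    rw [map_sum, map_sub, MvPowerSeries.coeff_C]
    by_cases he : e = 0
    · subst he
      rw [Finset.sum_eq_zero]
      · simp
      · intro i _
        rw [MvPowerSeries.X, MvPowerSeries.coeff_monomial_mul, if_neg]
        intro h
        have := h i
        simp at this
    · obtain ⟨j, hj, hej⟩ := hι e he
      rw [if_neg he, sub_zero, Finset.sum_eq_single j]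
      · have hle : Finsupp.single j 1 ≤ e := by
          rw [Finsupp.single_le_iff]; exact Nat.one_le_iff_ne_zero.2 hej
        rw [MvPowerSeries.X, MvPowerSeries.coeff_monomial_mul, if_pos hle, one_mul]
        change _ = (if _ then _ else _)
        rw [tsub_add_cancel_of_le hle, if_pos hj]
      · intro i _ hi
        rw [MvPowerSeries.X, MvPowerSeries.coeff_monomial_mul]
        split_ifs with hle
        · rw [one_mul]
          change (if _ then _ else _) = _
          rw [tsub_add_cancel_of_le hle, if_neg]
          rw [hj]
          exact fun h => hi (Option.some_injective _ h).symm
        · rfl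
      · simp
  rw [hfg]
  exact Ideal.sum_mem _ fun i _ => Ideal.mul_mem_right _ _ (Ideal.subset_span ⟨i, rfl⟩)

section InverseSystem
variable {K : Type*} [Ring K] {V : ℕ → Type*} [∀ m, AddCommGroup (V m)] [∀ m, Module K (V m)]

theorem exists_compatible_family_apply_eq (t : ∀ {m l : ℕ}, m ≤ l → V l →ₗ[K] V m)
    (hsurj : ∀ {m l : ℕ} (h : m ≤ l), Function.Surjective (t h))
    (hid : ∀ m (z : V m), t le_rfl z = z)
    (hcomp : ∀ {m l k : ℕ} (h : m ≤ l) (h' : l ≤ k) (z : V k), t h (t h' z) = t (h.trans h') z)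
    (m : ℕ) (z : V m) :
    ∃ f : ∀ m, V m, (∀ (m l : ℕ) (h : m ≤ l), t h (f l) = f m) ∧ f m = z := by
  choose s hs using fun k => hsurj (Nat.le_succ k)
  let F : ∀ k, V (m + k) := fun k => Nat.rec z (fun k y => s (m + k) y) k
  have hF (k : ℕ) : t (Nat.le_succ (m + k)) (F (k + 1)) = F k := hs (m + k) (F k)
  have hFl (k l : ℕ) (h : k ≤ l) : t (Nat.add_le_add_left h m) (F l) = F k := by
    induction l, h using Nat.le_induction with
    | base => exact hid _ _
    | succ l h ih => rw [← ih, ← hF l, hcomp]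
  -- `F l` lives at level `m + l ≥ l`, so projecting it down defines all components, including those
  -- below `m`.
  refine ⟨fun l => t (Nat.le_add_left l m) (F l), ?_, ?_⟩
  · intro a b hab
    dsimp only
    rw [hcomp, ← hFl a b hab, hcomp]
  · exact hFl 0 m (Nat.zero_le m)

end InverseSystem

section
variable {A : Type*} [CommRing A] (n : ℕ) (M : Type*) [AddCommGroup M] [Module A M]
  [Module (MvPowerSeries (Fin n) A) M] [IsScalarTower A (MvPowerSeries (Fin n) A) M]

theorem variableIdeal_fg : (variableIdeal A n).FG :=
  Submodule.fg_span (Set.finite_range _)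

/-- Modulo `⟨x⟩I`, a power series acts on `I` through its constant coefficient, so generators over
the power series ring already generate over `A`. -/
theorem exists_fg_restrictScalars_le_sup (I : Submodule (MvPowerSeries (Fin n) A) M)
    (hI : I.FG) : ∃ L : Submodule A M, L.FG ∧
      I.restrictScalars A ≤ L ⊔ (variableIdeal A n • I).restrictScalars A := by
  obtain ⟨s, hs⟩ := hI
  refine ⟨Submodule.span A s, ⟨s, rfl⟩, ?_⟩
  intro y hy
  rw [Submodule.restrictScalars_mem, ← hs] at hy
  induction hy using Submodule.span_induction with
  | mem x hx => exact Submodule.mem_sup_left (Submodule.subset_span hx)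
  | zero => exact zero_mem _
  | add x y _ _ hx hy => exact add_mem hx hy
  | smul f x hxs hx =>
    have hsplit : f • x = MvPowerSeries.constantCoeff f • x +
        (f - MvPowerSeries.C (MvPowerSeries.constantCoeff f)) • x := by
      have : MvPowerSeries.constantCoeff f • x =
          (MvPowerSeries.C (MvPowerSeries.constantCoeff f) : MvPowerSeries (Fin n) A) • x :=
        (algebraMap_smul (MvPowerSeries (Fin n) A) (MvPowerSeries.constantCoeff f) x).symm
      rw [this, ← add_smul, add_sub_cancel]
    have hmem : (f - MvPowerSeries.C (MvPowerSeries.constantCoeff f)) • x ∈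
        variableIdeal A n • I :=
      Submodule.smul_mem_smul (MvPowerSeries.sub_C_constantCoeff_mem_variableIdeal f) (hs ▸ hxs)
    rw [hsplit]
    exact add_mem (Submodule.smul_mem _ _ hx) (Submodule.mem_sup_right hmem)

theorem exists_fg_sup_pow_eq_top [Module.Finite (MvPowerSeries (Fin n) A) M] (m : ℕ) :
    ∃ L : Submodule A M, L.FG ∧
      L ⊔ (variableIdeal A n ^ m • ⊤ : Submodule (MvPowerSeries (Fin n) A) M).restrictScalars A
        = ⊤ := by
  induction m with
  | zero => exact ⟨⊥, Submodule.fg_bot, by simp⟩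
  | succ m ih =>
    obtain ⟨L, hL, hLt⟩ := ih
    obtain ⟨L', hL', hLt'⟩ := exists_fg_restrictScalars_le_sup n M
      (variableIdeal A n ^ m • ⊤ : Submodule (MvPowerSeries (Fin n) A) M)
      (Submodule.FG.smul (Ideal.FG.pow (variableIdeal_fg n)) Module.Finite.fg_top)
    refine ⟨L ⊔ L', hL.sup hL', ?_⟩
    rw [eq_top_iff, ← hLt, sup_assoc]
    rw [← Submodule.mul_smul, ← pow_succ'] at hLt'
    exact sup_le_sup_left hLt' L

/-- The projection `M → M / ⟨x⟩ᵐ M` as an `A`-linear map. -/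
noncomputable def truncatedMk (m : ℕ) : M →ₗ[A] TruncatedModule A n M m :=
  (Submodule.mkQ (variableIdeal A n ^ m • ⊤ :
    Submodule (MvPowerSeries (Fin n) A) M)).restrictScalars A

theorem truncatedMk_apply (m : ℕ) (y : M) :
    truncatedMk (A := A) n M m y = Submodule.Quotient.mk y := rfl

theorem truncatedMk_surjective (m : ℕ) : Function.Surjective (truncatedMk (A := A) n M m) := by
  intro z
  obtain ⟨y, rfl⟩ := Submodule.Quotient.mk_surjective _ z
  exact ⟨y, rfl⟩

theorem truncatedMk_eq_zero_iff (m : ℕ) (y : M) : truncatedMk (A := A) n M m y = 0 ↔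
    y ∈ (variableIdeal A n ^ m • ⊤ : Submodule (MvPowerSeries (Fin n) A) M) := by
  rw [truncatedMk_apply, Submodule.Quotient.mk_eq_zero]

theorem TruncatedModule.finite [Module.Finite (MvPowerSeries (Fin n) A) M] (m : ℕ) :
    Module.Finite A (TruncatedModule A n M m) := by
  obtain ⟨L, hL, hLt⟩ := exists_fg_sup_pow_eq_top (A := A) n M m
  have hf := truncatedMk_surjective (A := A) n M m
  refine ⟨?_⟩
  have : Submodule.map (truncatedMk n M m) L = ⊤ := by
    have h := congrArg (Submodule.map (truncatedMk n M m)) hLt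
    rw [Submodule.map_sup, Submodule.map_top, LinearMap.range_eq_top.2 hf, sup_eq_left.2] at h
    · exact h
    · rintro _ ⟨y, hy, rfl⟩
      rw [(truncatedMk_eq_zero_iff n M m y).2 hy]; exact zero_mem _
  rw [← this]
  exact hL.map _

/-- The projection `M / ⟨x⟩ˡ M → M / ⟨x⟩ᵐ M` for `m ≤ l`, as an `A`-linear map. -/
noncomputable def truncatedProj {m l : ℕ} (h : m ≤ l) :
    TruncatedModule A n M l →ₗ[A] TruncatedModule A n M m :=
  (Submodule.factorPow (variableIdeal A n) M h).restrictScalars A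

theorem truncatedProj_mk {m l : ℕ} (h : m ≤ l) (y : M) :
    truncatedProj n M h (truncatedMk (A := A) n M l y) = truncatedMk n M m y := rfl

theorem truncatedProj_surjective {m l : ℕ} (h : m ≤ l) :
    Function.Surjective (truncatedProj (A := A) n M h) := by
  intro z
  obtain ⟨y, rfl⟩ := truncatedMk_surjective n M m z
  exact ⟨_, truncatedProj_mk n M h y⟩

theorem truncatedTransition_eq (B : Type*) [CommRing B] [Algebra A B] {m l : ℕ} (h : m ≤ l) :
    truncatedTransition n M B h = (truncatedProj (A := A) n M h).baseChange B := rfl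

theorem truncatedTransition_surjective (B : Type*) [CommRing B] [Algebra A B] {m l : ℕ}
    (h : m ≤ l) : Function.Surjective (truncatedTransition (A := A) n M B h) := by
  rw [truncatedTransition_eq]
  exact LinearMap.lTensor_surjective B (truncatedProj_surjective n M h)

theorem truncatedTransition_tmul_mk (B : Type*) [CommRing B] [Algebra A B] {m l : ℕ}
    (h : m ≤ l) (b : B) (y : M) : truncatedTransition (A := A) n M B h
      (b ⊗ₜ truncatedMk n M l y) = b ⊗ₜ truncatedMk n M m y := by
  rw [truncatedTransition_eq, LinearMap.baseChange_tmul, truncatedProj_mk]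

theorem truncatedTransition_comp (B : Type*) [CommRing B] [Algebra A B] {m l k : ℕ}
    (h : m ≤ l) (h' : l ≤ k) (z : B ⊗[A] TruncatedModule A n M k) :
    truncatedTransition n M B h (truncatedTransition n M B h' z) =
      truncatedTransition n M B (h.trans h') z := by
  induction z with
  | zero => simp only [map_zero]
  | add x y hx hy => simp only [map_add, hx, hy]
  | tmul b y =>
    obtain ⟨y, rfl⟩ := truncatedMk_surjective n M _ y
    simp only [truncatedTransition_tmul_mk]

theorem truncatedTransition_refl (B : Type*) [CommRing B] [Algebra A B] (m : ℕ)
    (z : B ⊗[A] TruncatedModule A n M m) : truncatedTransition n M B le_rfl z = z := by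
  induction z with
  | zero => simp only [map_zero]
  | add x y hx hy => simp only [map_add, hx, hy]
  | tmul b y =>
    obtain ⟨y, rfl⟩ := truncatedMk_surjective n M _ y
    rw [truncatedTransition_tmul_mk]

theorem exists_mem_completedTensorProduct_apply_eq (B : Type*) [CommRing B] [Algebra A B] (m : ℕ)
    (z : B ⊗[A] TruncatedModule A n M m) :
    ∃ f ∈ completedTensorProduct (A := A) n M B, f m = z :=
  exists_compatible_family_apply_eq (V := fun m => B ⊗[A] TruncatedModule A n M m)
    (truncatedTransition n M B) (truncatedTransition_surjective n M B)
    (truncatedTransition_refl n M B) (truncatedTransition_comp n M B) m z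

end

/-! ### Bounded dimensions and uniform multipliers -/

theorem exists_forall_le_apply_of_bounded {r : ℕ → ℕ} {d : ℕ} (hr : ∀ m, r m ≤ d) :
    ∃ m₀, ∀ m, r m ≤ r m₀ := by
  have hb : BddAbove (Set.range r) := ⟨d, by rintro _ ⟨m, rfl⟩; exact hr m⟩
  obtain ⟨m₀, h⟩ := Nat.sSup_mem (Set.range_nonempty r) hb
  exact ⟨m₀, fun m => h ▸ le_csSup hb ⟨m, rfl⟩⟩

theorem finrank_le_of_rank_submodule_pi_le {K : Type*} [Field K] {V : ℕ → Type*}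
    [∀ m, AddCommGroup (V m)] [∀ m, Module K (V m)] (L : Submodule K (∀ m, V m))
    (hL : ∀ m (z : V m), ∃ f ∈ L, f m = z) {d : ℕ} (h : Module.rank K L ≤ d) (m : ℕ) :
    Module.finrank K (V m) ≤ d := by
  have hfin : Module.Finite K L :=
    Module.rank_lt_aleph0_iff.1 (h.trans_lt Cardinal.natCast_lt_aleph0)
  have hsurj : Function.Surjective
      ((LinearMap.proj m : (∀ m, V m) →ₗ[K] V m) ∘ₗ L.subtype) := by
    intro z
    obtain ⟨f, hf, hfz⟩ := hL m z
    exact ⟨⟨f, hf⟩, hfz⟩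
  rw [← Module.finrank_eq_rank, Nat.cast_le] at h
  exact (LinearMap.finrank_le_finrank_of_surjective hsurj).trans h

/-- Bounded dimensions attain their maximum at some `m₀`; beyond it the surjective transitions are
injective, so a compatible family is determined by its component at `m₀`. -/
theorem rank_compatible_families_le {K : Type*} [Field K] {V : ℕ → Type*}
    [∀ m, AddCommGroup (V m)] [∀ m, Module K (V m)] [∀ m, Module.Finite K (V m)]
    (t : ∀ {m l : ℕ}, m ≤ l → V l →ₗ[K] V m)
    (hsurj : ∀ {m l : ℕ} (h : m ≤ l), Function.Surjective (t h))
    (L : Submodule K (∀ m, V m)) (hL : ∀ f ∈ L, ∀ (m l : ℕ) (h : m ≤ l), t h (f l) = f m)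
    {d : ℕ} (hd : ∀ m, Module.finrank K (V m) ≤ d) : Module.rank K L ≤ d := by
  obtain ⟨m₀, hm₀⟩ := exists_forall_le_apply_of_bounded hd
  have hinj (l : ℕ) (h : m₀ ≤ l) : Function.Injective (t h) := by
    have heq : Module.finrank K (V l) = Module.finrank K (V m₀) :=
      le_antisymm (hm₀ l) (LinearMap.finrank_le_finrank_of_surjective (hsurj h))
    exact (LinearMap.injective_iff_surjective_of_finrank_eq_finrank heq).2 (hsurj h)
  have hpi : Function.Injective ((LinearMap.proj m₀ : (∀ m, V m) →ₗ[K] V m₀) ∘ₗ L.subtype) := by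
    rw [injective_iff_map_eq_zero]
    rintro ⟨f, hf⟩ (h0 : f m₀ = 0)
    ext m
    change f m = 0
    have h1 : f (max m₀ m) = 0 := by
      apply hinj _ (le_max_left m₀ m)
      rw [hL f hf, h0, map_zero]
    rw [← hL f hf m _ (le_max_right m₀ m), h1, map_zero]
  have := Module.Finite.of_injective _ hpi
  rw [← Module.finrank_eq_rank]
  exact_mod_cast (LinearMap.finrank_le_finrank_of_injective hpi).trans (hd m₀)

/-- An element of a finitely generated module that is locally multiplied into `W` is uniformly
multiplied into `W`. -/
theorem exists_uniform_smul_mem {A R M : Type*} [CommRing A] [CommRing R] [Algebra A R]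
    [AddCommGroup M] [Module A M] [Module R M] [IsScalarTower A R M] (p : Ideal A) [p.IsPrime]
    (I W : Submodule R M) (hI : I.FG) (h : ∀ y ∈ I, ∃ s ∉ p, s • y ∈ W) :
    ∃ a ∉ p, ∀ y ∈ I, a • y ∈ W := by
  classical
  obtain ⟨t, rfl⟩ := hI
  choose! s hs hsW using fun y (hy : y ∈ (t : Set M)) => h y (Submodule.subset_span hy)
  refine ⟨∏ y ∈ t, s y, fun hmem => ?_, fun y hy => ?_⟩
  · obtain ⟨y, hy, hy'⟩ := (Ideal.IsPrime.prod_mem_iff (p := p)).1 hmem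
    exact hs y hy hy'
  · induction hy using Submodule.span_induction with
    | mem y hy =>
      rw [← Finset.prod_erase_mul t s hy, mul_smul]
      exact W.smul_of_tower_mem _ (hsW y hy)
    | zero => rw [smul_zero]; exact zero_mem _
    | add x y _ _ hx hy => rw [smul_add]; exact add_mem hx hy
    | smul f x _ hx => rw [smul_comm]; exact W.smul_mem f hx

/-- Multiplying the inclusion at level `j` by `J` gives the one at level `j + 1`, with the same `a`.
-/
theorem smul_mem_pow_succ_smul_sup {A R M : Type*} [CommRing A] [CommRing R] [Algebra A R]
    [AddCommGroup M] [Module A M] [Module R M] [IsScalarTower A R M] (J : Ideal R)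
    (P : Submodule R M) (a : A) (m₀ : ℕ)
    (h : ∀ y ∈ (J ^ m₀ • ⊤ : Submodule R M), a • y ∈ J ^ (m₀ + 1) • ⊤ ⊔ P)
    (j : ℕ) (hj : m₀ ≤ j) :
    ∀ y ∈ (J ^ j • ⊤ : Submodule R M), a • y ∈ J ^ (j + 1) • ⊤ ⊔ P := by
  induction j, hj using Nat.le_induction with
  | base => exact h
  | succ j _ ih =>
    intro y hy
    rw [pow_succ', Submodule.mul_smul] at hy
    induction hy using Submodule.smul_induction_on' with
    | smul f hf z hz =>
      obtain ⟨u, hu, w, hw, huw⟩ := Submodule.mem_sup.1 (ih z hz)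
      rw [smul_comm, ← huw, smul_add]
      refine add_mem (Submodule.mem_sup_left ?_) (Submodule.mem_sup_right (P.smul_mem f hw))
      rw [pow_succ', Submodule.mul_smul]
      exact Submodule.smul_mem_smul hf hu
    | add x _ y _ hx hy => rw [smul_add]; exact add_mem hx hy

/-! ### Truncated fibre dimensions: stabilisation and generization -/

section
variable {A : Type*} [CommRing A] (n : ℕ) (M : Type*) [AddCommGroup M] [Module A M]
  [Module (MvPowerSeries (Fin n) A) M] [IsScalarTower A (MvPowerSeries (Fin n) A) M]

/-- The dimension of the fibre of `M / ⟨x⟩ᵐ M` at the prime `q`. -/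
noncomputable def truncatedFibreDim (q : PrimeSpectrum A) (m : ℕ) : ℕ :=
  Module.finrank q.asIdeal.ResidueField (q.asIdeal.ResidueField ⊗[A] TruncatedModule A n M m)

theorem one_tmul_eq_zero_of_smul {q : PrimeSpectrum A} {N : Type*} [AddCommGroup N] [Module A N]
    {a : A} (ha : a ∉ q.asIdeal) {y : N}
    (h : (1 : q.asIdeal.ResidueField) ⊗ₜ[A] (a • y) = 0) :
    (1 : q.asIdeal.ResidueField) ⊗ₜ[A] y = 0 := by
  rw [TensorProduct.tmul_smul, ← algebraMap_smul q.asIdeal.ResidueField a] at h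
  refine (smul_eq_zero.1 h).resolve_left ?_
  exact fun h0 => ha (Ideal.algebraMap_residueField_eq_zero.1 h0)

theorem one_tmul_eq_zero_of_mem_smul_top {q : PrimeSpectrum A} {N : Type*} [AddCommGroup N]
    [Module A N] {I : Ideal A} (hI : I ≤ q.asIdeal) {y : N} (h : y ∈ (I • ⊤ : Submodule A N)) :
    (1 : q.asIdeal.ResidueField) ⊗ₜ[A] y = 0 := by
  induction h using Submodule.smul_induction_on' with
  | smul a ha y _ =>
    rw [← TensorProduct.smul_tmul, ← Algebra.algebraMap_eq_smul_one,
      Ideal.algebraMap_residueField_eq_zero.2 (hI ha), TensorProduct.zero_tmul]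
  | add x _ y _ hx hy => rw [TensorProduct.tmul_add, hx, hy, add_zero]

section
variable [Module.Finite (MvPowerSeries (Fin n) A) M]

theorem truncatedFibreDim_mono (q : PrimeSpectrum A) : Monotone (truncatedFibreDim n M q) := by
  intro m l h
  have := TruncatedModule.finite (A := A) n M l
  exact LinearMap.finrank_le_finrank_of_surjective
    (truncatedTransition_surjective n M q.asIdeal.ResidueField h)

theorem rank_completedTensorProduct_le_natCast_iff (K : Type*) [Field K] [Algebra A K] (d : ℕ) :
    Module.rank K (completedTensorProduct (A := A) n M K) ≤ d ↔
      ∀ m, Module.finrank K (K ⊗[A] TruncatedModule A n M m) ≤ d := by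
  have hfin := TruncatedModule.finite (A := A) n M
  constructor
  · exact finrank_le_of_rank_submodule_pi_le (V := fun m => K ⊗[A] TruncatedModule A n M m)
      (completedTensorProduct (A := A) n M K)
      (exists_mem_completedTensorProduct_apply_eq n M K)
  · exact rank_compatible_families_le (V := fun m => K ⊗[A] TruncatedModule A n M m)
      (truncatedTransition n M K) (truncatedTransition_surjective n M K)
      (completedTensorProduct (A := A) n M K) (fun f hf => hf)

theorem completedFibreDim_le_natCast_iff (q : PrimeSpectrum A) (d : ℕ) :
    completedFibreDim n M q ≤ d ↔ ∀ m, truncatedFibreDim n M q m ≤ d := by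
  rw [completedFibreDim, Cardinal.toENat_le_natCast]
  exact rank_completedTensorProduct_le_natCast_iff n M q.asIdeal.ResidueField d

theorem truncatedTransition_injective_of_finrank_le (K : Type*) [Field K] [Algebra A K] {m l : ℕ}
    (h : m ≤ l) (hle : Module.finrank K (K ⊗[A] TruncatedModule A n M l) ≤
      Module.finrank K (K ⊗[A] TruncatedModule A n M m)) :
    Function.Injective (truncatedTransition (A := A) n M K h) := by
  have hfin := TruncatedModule.finite (A := A) n M
  have hsurj := truncatedTransition_surjective (A := A) n M K h
  exact (LinearMap.injective_iff_surjective_of_finrank_eq_finrank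
    (le_antisymm hle (LinearMap.finrank_le_finrank_of_surjective hsurj))).2 hsurj

/-- Without growth of dimension the transition map at `η` is injective, so `y` dies in the fibre at
level `m + 1`; such vanishing means torsion modulo `η`. -/
theorem exists_smul_mem_sup_of_truncatedFibreDim_eq (η : PrimeSpectrum A) (m : ℕ)
    (h : truncatedFibreDim n M η (m + 1) ≤ truncatedFibreDim n M η m) (y : M)
    (hy : y ∈ (variableIdeal A n ^ m • ⊤ : Submodule (MvPowerSeries (Fin n) A) M)) :
    ∃ s ∉ η.asIdeal, s • y ∈ (variableIdeal A n ^ (m + 1) • ⊤ ⊔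
      η.asIdeal.map (algebraMap A (MvPowerSeries (Fin n) A)) • ⊤ :
        Submodule (MvPowerSeries (Fin n) A) M) := by
  have hinj := truncatedTransition_injective_of_finrank_le n M η.asIdeal.ResidueField
    (Nat.le_succ m) h
  have h0 : (1 : η.asIdeal.ResidueField) ⊗ₜ[A] truncatedMk (A := A) n M (m + 1) y = 0 := by
    apply hinj
    rw [truncatedTransition_tmul_mk, (truncatedMk_eq_zero_iff n M m y).2 hy,
      TensorProduct.tmul_zero, map_zero]
  obtain ⟨s, hs, hsy⟩ := exists_smul_mem_of_one_tmul_eq_zero η.asIdeal _ h0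
  refine ⟨s, hs, ?_⟩
  rw [← LinearMap.range_eq_top.2 (truncatedMk_surjective (A := A) n M (m + 1)),
    ← Submodule.map_top, ← Submodule.map_smul'', ← map_smul] at hsy
  obtain ⟨w, hw, hwy⟩ := hsy
  have hsub : s • y - w ∈
      (variableIdeal A n ^ (m + 1) • ⊤ : Submodule (MvPowerSeries (Fin n) A) M) := by
    rw [← truncatedMk_eq_zero_iff (A := A), map_sub, hwy, sub_self]
  have hw' : w ∈ (η.asIdeal.map (algebraMap A (MvPowerSeries (Fin n) A)) • ⊤ :
      Submodule (MvPowerSeries (Fin n) A) M) := by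
    rw [← Submodule.restrictScalars_mem A, Ideal.smul_restrictScalars]
    exact hw
  rw [← sub_add_cancel (s • y) w]
  exact add_mem (Submodule.mem_sup_left hsub) (Submodule.mem_sup_right hw')

/-- At `q` the element `a` is invertible and `η` acts as zero. The class of `y ∈ ⟨x⟩^m₀ M` can
therefore be pushed into ever higher powers until it vanishes at level `l`, which makes the
transition from `l` to `m₀` injective. -/
theorem truncatedFibreDim_le_of_smul_mem (η q : PrimeSpectrum A) (hηq : η ≤ q) {a : A}
    (ha : a ∉ q.asIdeal) (m₀ : ℕ)
    (h : ∀ y ∈ (variableIdeal A n ^ m₀ • ⊤ : Submodule (MvPowerSeries (Fin n) A) M),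
      a • y ∈ (variableIdeal A n ^ (m₀ + 1) • ⊤ ⊔
        η.asIdeal.map (algebraMap A (MvPowerSeries (Fin n) A)) • ⊤ :
          Submodule (MvPowerSeries (Fin n) A) M)) (l : ℕ) :
    truncatedFibreDim n M q l ≤ truncatedFibreDim n M q m₀ := by
  rcases le_total l m₀ with hl | hl
  · exact truncatedFibreDim_mono n M q hl
  have hfin := TruncatedModule.finite (A := A) n M
  -- The induction descends in `j` from `l`, with `k` the number of remaining steps.
  have key (k j : ℕ) (hjk : j + k = l) (hj : m₀ ≤ j) (y : M)
      (hy : y ∈ (variableIdeal A n ^ j • ⊤ : Submodule (MvPowerSeries (Fin n) A) M)) :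
      (1 : q.asIdeal.ResidueField) ⊗ₜ[A] truncatedMk (A := A) n M l y = 0 := by
    induction k generalizing j y with
    | zero =>
      obtain rfl : j = l := hjk
      rw [(truncatedMk_eq_zero_iff n M _ y).2 hy, TensorProduct.tmul_zero]
    | succ k ih =>
      obtain ⟨u, hu, w, hw, huw⟩ := Submodule.mem_sup.1
        (smul_mem_pow_succ_smul_sup (variableIdeal A n) _ a m₀ h j hj y hy)
      apply one_tmul_eq_zero_of_smul ha
      rw [← map_smul, ← huw, map_add, TensorProduct.tmul_add,
        ih (j + 1) (by omega) (by omega) u hu, zero_add]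
      rw [← Submodule.restrictScalars_mem A, Ideal.smul_restrictScalars] at hw
      refine one_tmul_eq_zero_of_mem_smul_top (I := η.asIdeal) hηq ?_
      have := Submodule.mem_map_of_mem (f := truncatedMk (A := A) n M l) hw
      rw [Submodule.map_smul''] at this
      exact Submodule.smul_mono le_rfl le_top this
  refine LinearMap.finrank_le_finrank_of_injective
    (f := truncatedTransition n M q.asIdeal.ResidueField hl) ?_
  rw [injective_iff_map_eq_zero]
  intro z hz
  rw [truncatedTransition_eq] at hz
  have hex := lTensor_exact q.asIdeal.ResidueField
    (LinearMap.exact_subtype_ker_map (truncatedProj (A := A) n M hl))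
    (truncatedProj_surjective n M hl)
  obtain ⟨w, rfl⟩ := (hex z).1 hz
  clear hz
  induction w with
  | zero => rw [map_zero]
  | add x y hx hy => rw [map_add, hx, hy, add_zero]
  | tmul c v =>
    obtain ⟨v, hv⟩ := v
    obtain ⟨y, rfl⟩ := truncatedMk_surjective n M _ v
    rw [LinearMap.mem_ker, truncatedProj_mk, truncatedMk_eq_zero_iff] at hv
    rw [LinearMap.lTensor_tmul, Submodule.subtype_apply, ← mul_one c, ← smul_eq_mul,
      ← TensorProduct.smul_tmul', key (l - m₀) m₀ (by omega) le_rfl y hv, smul_zero]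

/-- If all truncated fibre dimensions at `η` are at most `d`, then so they are at the points of a
nonempty open subset of the closure of `η`. -/
theorem exists_notMem_forall_truncatedFibreDim_le (η : PrimeSpectrum A) {d : ℕ}
    (hd : ∀ m, truncatedFibreDim n M η m ≤ d) :
    ∃ a ∉ η.asIdeal, ∀ q : PrimeSpectrum A, η ≤ q → a ∉ q.asIdeal →
      ∀ m, truncatedFibreDim n M q m ≤ d := by
  obtain ⟨m₀, hm₀⟩ := exists_forall_le_apply_of_bounded hd
  obtain ⟨a, ha, haW⟩ := exists_uniform_smul_mem η.asIdeal _ _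
    (Submodule.FG.smul (Ideal.FG.pow (variableIdeal_fg n)) Module.Finite.fg_top)
    (exists_smul_mem_sup_of_truncatedFibreDim_eq n M η m₀ (hm₀ (m₀ + 1)))
  have hfin := TruncatedModule.finite (A := A) n M
  obtain ⟨U, hU, hηU, hUle⟩ := exists_open_finrank_fiber_le (TruncatedModule A n M m₀) η
  obtain ⟨_, ⟨b, rfl⟩, hb, hbU⟩ :=
    PrimeSpectrum.isTopologicalBasis_basic_opens.exists_subset_of_mem_open hηU hU
  refine ⟨a * b, fun h => (η.2.mem_or_mem h).elim ha hb, fun q hηq hq m => ?_⟩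
  have haq : a ∉ q.asIdeal := fun h => hq (Ideal.mul_mem_right _ _ h)
  have hbq : b ∉ q.asIdeal := fun h => hq (Ideal.mul_mem_left _ _ h)
  exact (truncatedFibreDim_le_of_smul_mem n M η q hηq haq m₀ haW m).trans
    ((hUle q (hbU hbq)).trans (hd m₀))

/-- Open sets are stable under generization, so `q` lies in the semicontinuity neighbourhood of `p`
for every `m`. -/
theorem truncatedFibreDim_le_of_le {q p : PrimeSpectrum A} (h : q ≤ p) (m : ℕ) :
    truncatedFibreDim n M q m ≤ truncatedFibreDim n M p m := by
  have hfin := TruncatedModule.finite (A := A) n M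
  obtain ⟨U, hU, hpU, hUle⟩ := exists_open_finrank_fiber_le (TruncatedModule A n M m) p
  exact hUle q (((PrimeSpectrum.le_iff_specializes _ _).1 h).mem_open hU hpU)

end

theorem truncatedFibreDim_eq_zero {q : PrimeSpectrum A}
    (hq : ¬ Module.annihilator A M ≤ q.asIdeal) (m : ℕ) : truncatedFibreDim n M q m = 0 := by
  obtain ⟨s, hs, hsq⟩ := SetLike.not_le_iff_exists.1 hq
  have : Subsingleton (q.asIdeal.ResidueField ⊗[A] TruncatedModule A n M m) := by
    refine subsingleton_of_forall_eq 0 fun z => ?_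
    induction z with
    | zero => rfl
    | add x y hx hy => rw [hx, hy, add_zero]
    | tmul c v =>
      obtain ⟨y, rfl⟩ := truncatedMk_surjective n M _ v
      rw [← mul_one c, ← smul_eq_mul, ← TensorProduct.smul_tmul', one_tmul_eq_zero_of_smul hsq,
        smul_zero]
      rw [← map_smul, Module.mem_annihilator.1 hs, map_zero, TensorProduct.tmul_zero]
  exact Module.finrank_zero_of_subsingleton

/-- `M` need not be finite over `A`. Its finitely many generators over the power series ring still
give a common annihilator outside `q` whenever `M` localizes to zero there. -/
theorem mem_support_of_annihilator_le [Module.Finite (MvPowerSeries (Fin n) A) M]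
    {q : PrimeSpectrum A} (hq : Module.annihilator A M ≤ q.asIdeal) : q ∈ Module.support A M := by
  by_contra h
  rw [Module.notMem_support_iff'] at h
  obtain ⟨a, ha, haM⟩ := exists_uniform_smul_mem (R := MvPowerSeries (Fin n) A) q.asIdeal
    (⊤ : Submodule (MvPowerSeries (Fin n) A) M) ⊥ Module.Finite.fg_top
    (fun y _ => by simpa using h y)
  exact ha (hq (Module.mem_annihilator.2 fun y => by simpa using haM y trivial))

end

/-! ### Chains of primes in the support -/

theorem two_le_topologicalKrullDim_of_specializes {Y : Type*} [TopologicalSpace Y] {x y z : Y}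
    (hxy : x ⤳ y) (hyz : y ⤳ z) (hyx : ¬ y ⤳ x) (hzy : ¬ z ⤳ y) : 2 ≤ topologicalKrullDim Y := by
  let c (w : Y) : TopologicalSpace.IrreducibleCloseds Y :=
    ⟨closure {w}, isIrreducible_singleton.closure, isClosed_closure⟩
  have hc {u v : Y} (h : u ⤳ v) (h' : ¬ v ⤳ u) : c v < c u := by
    refine lt_of_le_not_ge ?_ fun hle => h' ?_
    · change closure {v} ⊆ closure {u}
      exact specializes_iff_closure_subset.1 h
    · exact specializes_iff_closure_subset.2 hle
  let s : LTSeries (TopologicalSpace.IrreducibleCloseds Y) :=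
    { length := 2
      toFun := ![c z, c y, c x]
      step := fun i => by fin_cases i; exacts [hc hyz hzy, hc hxy hyx] }
  exact Order.LTSeries.length_le_krullDim s

/-- Some neighbourhood `U` has `U ∩ S` of dimension below two. Only `z` has to be taken in `U`,
since `x` and `y` are generizations of it. -/
theorem exists_open_not_lt_lt_of_localKrullDimAt_le_one {A : Type*} [CommRing A]
    {S : Set (PrimeSpectrum A)} {p : PrimeSpectrum A} (h : localKrullDimAt S p ≤ 1) :
    ∃ U : Set (PrimeSpectrum A), IsOpen U ∧ p ∈ U ∧ ∀ x ∈ S, ∀ y ∈ S, ∀ z ∈ U ∩ S,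
      x < y → ¬ y < z := by
  have h2 : localKrullDimAt S p < 2 := h.trans_lt (by
    exact_mod_cast (WithBot.coe_lt_coe.2 (by norm_num : (1 : ℕ∞) < 2)))
  rw [localKrullDimAt, iInf_lt_iff] at h2
  obtain ⟨U, hU⟩ := h2
  rw [iInf_lt_iff] at hU
  obtain ⟨⟨hUo, hpU⟩, hU⟩ := hU
  refine ⟨U, hUo, hpU, fun x hx y hy z hz hxy hyz => hU.not_ge ?_⟩
  have hyU : y ∈ U := ((PrimeSpectrum.le_iff_specializes _ _).1 hyz.le).mem_open hUo hz.1
  have hxU : x ∈ U := ((PrimeSpectrum.le_iff_specializes _ _).1 hxy.le).mem_open hUo hyU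
  have hsp (u v : (U ∩ S : Set (PrimeSpectrum A))) : u ⤳ v ↔ u.1 ≤ v.1 := by
    rw [Topology.IsInducing.subtypeVal.specializes_iff.symm, PrimeSpectrum.le_iff_specializes]
  refine two_le_topologicalKrullDim_of_specializes (x := ⟨x, hxU, hx⟩) (y := ⟨y, hyU, hy⟩)
    (z := ⟨z, hz⟩) ?_ ?_ ?_ ?_ <;> rw [hsp]
  exacts [hxy.le, hyz.le, hxy.not_ge, hyz.not_ge]

/-! ### Semicontinuity of the completed fibre dimension -/

theorem theorem1p12 {A : Type*} [CommRing A] [IsNoetherianRing A] (n : ℕ)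
    (M : Type*) [AddCommGroup M] [Module A M] [Module (MvPowerSeries (Fin n) A) M]
    [IsScalarTower A (MvPowerSeries (Fin n) A) M]
    [Module.Finite (MvPowerSeries (Fin n) A) M]
    (p : PrimeSpectrum A)
    (hdim : localKrullDimAt (Module.support A M) p ≤ 1) :
    ∃ U : Set (PrimeSpectrum A), IsOpen U ∧ p ∈ U ∧
      ∀ q ∈ U, completedFibreDim n M q ≤ completedFibreDim n M p := by
  rcases eq_or_ne (completedFibreDim n M p) ⊤ with htop | htop
  · exact ⟨Set.univ, isOpen_univ, trivial, fun q _ => htop ▸ le_top⟩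
  obtain ⟨d, hd⟩ := ENat.ne_top_iff_exists.1 htop
  rw [← hd]
  simp only [completedFibreDim_le_natCast_iff]
  have hp := (completedFibreDim_le_natCast_iff n M p d).1 hd.ge
  have hgen {q : PrimeSpectrum A} (h : q ≤ p) (m : ℕ) : truncatedFibreDim n M q m ≤ d :=
    (truncatedFibreDim_le_of_le n M h m).trans (hp m)
  obtain ⟨U, hU, hpU, hchain⟩ := exists_open_not_lt_lt_of_localKrullDimAt_le_one hdim
  have hex (η : PrimeSpectrum A) : ∃ a : A, η ≤ p → a ∉ η.asIdeal ∧
      ∀ q : PrimeSpectrum A, η ≤ q → a ∉ q.asIdeal → ∀ m, truncatedFibreDim n M q m ≤ d := by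
    by_cases h : η ≤ p
    · obtain ⟨a, ha⟩ := exists_notMem_forall_truncatedFibreDim_le n M η (hgen h)
      exact ⟨a, fun _ => ha⟩
    · exact ⟨0, fun h' => absurd h' h⟩
  choose a ha using hex
  have hminfin : {η : PrimeSpectrum A | η.asIdeal ∈ (Module.annihilator A M).minimalPrimes}.Finite :=
    (Ideal.finite_minimalPrimes_of_isNoetherianRing A _).preimage
      (fun _ _ _ _ h => PrimeSpectrum.ext h)
  let F : Set (Ideal A) := (Module.annihilator A M).minimalPrimes ∪
    ⋃ η ∈ {η : PrimeSpectrum A | η.asIdeal ∈ (Module.annihilator A M).minimalPrimes},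
      (η.asIdeal ⊔ Ideal.span {a η}).minimalPrimes
  have hF : F.Finite := (Ideal.finite_minimalPrimes_of_isNoetherianRing A _).union
    (hminfin.biUnion fun η _ => Ideal.finite_minimalPrimes_of_isNoetherianRing A _)
  -- `W` removes the closed sets `V(ζ)` that miss `p`; it is open because `F` is finite, `A` being
  -- Noetherian.
  let W := ⋂ ζ ∈ {ζ ∈ F | ¬ ζ ≤ p.asIdeal}, (PrimeSpectrum.zeroLocus (ζ : Set A))ᶜ
  have hW : IsOpen W := (hF.subset (Set.sep_subset _ _)).isOpen_biInter fun ζ _ =>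
    (PrimeSpectrum.isClosed_zeroLocus _).isOpen_compl
  have hpW : p ∈ W := Set.mem_iInter₂.2 fun ζ hζ h => hζ.2 h
  have hWF {q : PrimeSpectrum A} (hq : q ∈ W) {ζ : Ideal A} (hζ : ζ ∈ F) (hζq : ζ ≤ q.asIdeal) :
      ζ ≤ p.asIdeal := by
    by_contra h
    exact Set.mem_iInter₂.1 hq ζ ⟨hζ, h⟩ hζq
  refine ⟨U ∩ W, hU.inter hW, ⟨hpU, hpW⟩, fun q ⟨hqU, hqW⟩ m => ?_⟩
  by_cases hq : Module.annihilator A M ≤ q.asIdeal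
  swap
  · rw [truncatedFibreDim_eq_zero n M hq]; exact Nat.zero_le d
  obtain ⟨η, hη, hηq⟩ := Ideal.exists_minimalPrimes_le hq
  have hηp := hWF hqW (Set.mem_union_left _ hη) hηq
  let η' : PrimeSpectrum A := ⟨η, hη.1.1⟩
  obtain ⟨haη, haq⟩ := ha η' hηp
  by_cases hmem : a η' ∈ q.asIdeal
  swap
  · exact haq q hηq hmem m
  obtain ⟨ζ, hζ, hζq⟩ := Ideal.exists_minimalPrimes_le (I := η ⊔ Ideal.span {a η'})
    (sup_le hηq ((Ideal.span_singleton_le_iff_mem _).2 hmem))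
  have hζp := hWF hqW (Set.mem_union_right _ (Set.mem_biUnion (x := η') hη hζ)) hζq
  let ζ' : PrimeSpectrum A := ⟨ζ, hζ.1.1⟩
  have hηζ : η' < ζ' := by
    refine lt_of_le_not_ge (le_sup_left.trans hζ.1.2) fun hle => haη (hle ?_)
    exact hζ.1.2 (Ideal.mem_sup_right (Ideal.mem_span_singleton_self _))
  have hann : Module.annihilator A M ≤ η'.asIdeal := hη.1.2
  have hnot := hchain η' (mem_support_of_annihilator_le n M hann) ζ'
    (mem_support_of_annihilator_le n M (hann.trans hηζ.le)) q
    ⟨hqU, mem_support_of_annihilator_le n M hq⟩ hηζ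
  -- A strict inclusion would give the chain `η' < ζ' < q` in the support. Hence `q = ζ'` is a
  -- generization of `p`.
  obtain rfl : ζ' = q := eq_of_le_of_not_lt hζq hnot
  exact hgen hζp m
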